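/- **Setting.** Eight parties $v_1,\dots,v_8$ hold systems $\overline{\mathcal H}^{v_k}=\mathcal H^{v_k}\otimes\mathcal H_a^{v_k}$, where every $\mathcal H^{v_k}$ is a qubit, $\mathcal H_a^{v_k}$ is an auxiliary qubit for $k\le 7$, and $\mathcal H_a^{v_8}$ is trivial; so $\dim\overline{\mathcal H}^{v_k}=4$ for $k\le 7$ and $\dim\overline{\mathcal H}^{v_8}=2$. Let $\overline{\mathcal H}=\bigotimes_k\overline{\mathcal H}^{v_k}$ and $\mathcal H=\bigotimes_k\mathcal H^{v_k}$. *LOCC within the configuration.* An LOCC protocol is a sequence of rounds; in each round one party performs a measurement with finitely many outcomes, given by measurement operators $\{M_m\}$ on its own system $\overline{\mathcal H}^{v_k}$ with $\sum_m M_m^\dagger M_m=\mathbb 1$, which may depend on all earlier outcomes, and broadcasts the outcome. An $r$-round LOCC consists of $r$ such rounds followed by a local measurement of every party depending on the $r$ outcomes. An LOCC map is the map obtained by forgetting all outcomes of an $r$-round LOCC, or more generally the limit as $r\to\infty$ of such maps along one protocol (the final local measurements may change with $r$). No party ever enlarges its system. *Common resource states.* A pure state $\phi\in\overline{\mathcal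 H}$ is a common resource state for a set $S$ of pure states of $\mathcal H$ if it is fully entangled (not a product vector with respect to any bipartition of the parties) and for each $\psi\in S$ there is an LOCC map $\mathcal E$ on $\overline{\mathcal H}$ such that tracing out all $\mathcal H_a^{v_k}$ from $\mathcal E(|\phi\rangle\langle\phi|)$ gives $|\psi\rangle\langle\psi|$. It consists of bipartite entanglement if there are a simple graph on the parties and, for each edge, a bipartite pure state shared by the two endpoints, such that $\phi$ is the image of the tensor product of these states under local isometries into the $\overline{\mathcal H}^{v_k}$. *Target set.* Consider a circuit of seven gates, the $j$-th of which is $\exp(\mathrm i\alpha_j Z\otimes Z)$ on a pair $e_j$ of the qubits $\mathcal H^{v_1},\dots,\mathcal H^{v_8}$. Let $|\psi(\boldsymbol\alpha)\rangle$ be its output on the input $|+\rangle^{\otimes 8}$, where $|+\rangle=(|0\rangle+|1\rangle)/\sqrt2$, and let $S_0=\{|\psi(\boldsymbol\alpha)\rangle:\boldsymbol\alpha\in[0,2\pi)^7\}$. **Theorem.** Suppose that the pairs $e_1,\dots,e_7$ are the edges of a tree on $\{v_1,\dots,v_8\}$ and that no path of this tree starting at $v_8$ is dominating (that is, for every path starting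 at $v_8$, some vertex is neither on the path nor adjacent to a vertex of the path). For example, the pairs may be $v_1v_2,\ v_3v_4,\ v_5v_6,\ v_7v_8,\ v_2v_4,\ v_6v_8,\ v_4v_8$. Then no common resource state for $S_0$ consists of bipartite entanglement; that is, the preparation of the states of $S_0$ in this configuration of system sizes, in the static setting, is not achievable using any common resource state consisting of bipartite entanglement. -/

import Mathlib

open Matrix Filter Topology

/-! ## Multipartite systems

The parties form a finite type `V`; party `v` holds the Hilbert space `ℂ^(X v)` with computational
basis `X v`.  The computational basis of the total system `⨂ v, ℂ^(X v)` is `∀ v, X v`; a vector of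
the total system is a function `(∀ v, X v) → ℂ` and an operator is a matrix indexed by
`∀ v, X v`. -/

/-- The product operator `⨂ v, M v`. -/
def tensorOp {V : Type} [Fintype V] {X : V → Type} (M : ∀ v, Matrix (X v) (X v) ℂ) :
    Matrix (∀ v, X v) (∀ v, X v) ℂ :=
  fun x y => ∏ v, M v (x v) (y v)

/-- The operator acting as `M` on the system of party `k` and as the identity on all the others. -/
def localOp {V : Type} [Fintype V] [DecidableEq V] {X : V → Type} [∀ v, DecidableEq (X v)]
    (k : V) (M : Matrix (X k) (X k) ℂ) : Matrix (∀ v, X v) (∀ v, X v) ℂ :=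
  tensorOp (Function.update (fun v => (1 : Matrix (X v) (X v) ℂ)) k M)

/-- A finite family of operators is a family of measurement operators: `∑ m, M_m† M_m = 1`. -/
def IsMeasurement {I m : Type} [Fintype I] [Fintype m] [DecidableEq m]
    (M : I → Matrix m m ℂ) : Prop :=
  ∑ i, (M i)ᴴ * M i = 1

/-- The operator `|ψ⟩⟨ψ|`. -/
def pureState {m : Type} (ψ : m → ℂ) : Matrix m m ℂ :=
  Matrix.vecMulVec ψ (star ψ)

/-- The vector `ψ` is normalized in the Euclidean norm. -/
def IsNormalized {m : Type} [Fintype m] (ψ : m → ℂ) : Prop :=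
  ∑ x, ‖ψ x‖ ^ 2 = 1

/-- `φ` is fully entangled: for every bipartition of the parties into two nonempty sets, `φ` is
not a product vector. -/
def FullyEntangled {V : Type} {X : V → Type} (φ : (∀ v, X v) → ℂ) : Prop :=
  ∀ A : Set V, A.Nonempty → Aᶜ.Nonempty →
    ¬ ∃ (f : (∀ v : A, X v) → ℂ) (g : (∀ v : (Aᶜ : Set V), X v) → ℂ),
      ∀ x : ∀ v, X v, φ x = f (fun v => x v) * g (fun v => x v)

/-! ## Local operations and classical communication -/

/-- A finite family of operators on the total system, labelled by (records of) outcomes. -/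
structure OpFamily {V : Type} (X : V → Type) where
  Outcome : Type
  fintypeOutcome : Fintype Outcome
  op : Outcome → Matrix (∀ v, X v) (∀ v, X v) ℂ

attribute [instance] OpFamily.fintypeOutcome

/-- The family before any round: one outcome, with the identity operator. -/
def OpFamily.trivial {V : Type} [Fintype V] {X : V → Type} [∀ v, DecidableEq (X v)] :
    OpFamily X where
  Outcome := Unit
  fintypeOutcome := inferInstance
  op := fun _ => 1

/-- The map `ρ ↦ ∑ i, M_i ρ M_i†` obtained by performing the family and forgetting the outcome. -/
def OpFamily.channel {V : Type} [Fintype V] [DecidableEq V] {X : V → Type} [∀ v, Fintype (X v)]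
    (F : OpFamily X) (ρ : Matrix (∀ v, X v) (∀ v, X v) ℂ) : Matrix (∀ v, X v) (∀ v, X v) ℂ :=
  ∑ i, F.op i * ρ * (F.op i)ᴴ

/-- `G` is LOCC linked to `F`: after outcome `i` of `F` has been broadcast, one party `k` performs a
measurement on its own system that may depend on `i`, and the outcome `m` is appended to `i`. -/
def LOCCLinked {V : Type} [Fintype V] [DecidableEq V] {X : V → Type} [∀ v, Fintype (X v)]
    [∀ v, DecidableEq (X v)] (F G : OpFamily X) : Prop :=
  ∃ (k : V) (n : F.Outcome → ℕ) (M : (i : F.Outcome) → Fin (n i) → Matrix (X k) (X k) ℂ)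
    (e : G.Outcome ≃ (i : F.Outcome) × Fin (n i)),
    (∀ i, IsMeasurement (M i)) ∧
    ∀ j, G.op j = localOp k (M (e j).1 (e j).2) * F.op (e j).1

/-- `G` is obtained from `F` by letting every party finally perform a measurement on its own system
that may depend on the outcome `i` of `F`. -/
def LocallyCorrected {V : Type} [Fintype V] [DecidableEq V] {X : V → Type} [∀ v, Fintype (X v)]
    [∀ v, DecidableEq (X v)] (F G : OpFamily X) : Prop :=
  ∃ (n : F.Outcome → V → ℕ)
    (M : (i : F.Outcome) → (v : V) → Fin (n i v) → Matrix (X v) (X v) ℂ)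
    (e : G.Outcome ≃ (i : F.Outcome) × (∀ v, Fin (n i v))),
    (∀ i v, IsMeasurement (M i v)) ∧
    ∀ j, G.op j = tensorOp (fun v => M (e j).1 v ((e j).2 v)) * F.op (e j).1

/-- `E` is an LOCC map: there are families `F r`, the non-correcting part of the first `r` rounds of
one protocol, each LOCC linked to the previous one, and `r`-round LOCC families `G r`, namely `F r`
followed by local measurements of all the parties, whose maps converge to `E` as `r → ∞`.
Finite-round LOCC is the case in which the sequence of maps is eventually constant.  All operators
act on the given systems `X v`: no party ever enlarges its system. -/
def IsLOCCMap {V : Type} [Fintype V] [DecidableEq V] {X : V → Type} [∀ v, Fintype (X v)]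
    [∀ v, DecidableEq (X v)]
    (E : Matrix (∀ v, X v) (∀ v, X v) ℂ →ₗ[ℂ] Matrix (∀ v, X v) (∀ v, X v) ℂ) : Prop :=
  ∃ F G : ℕ → OpFamily X,
    F 0 = OpFamily.trivial ∧
    (∀ r, LOCCLinked (F r) (F (r + 1))) ∧
    (∀ r, LocallyCorrected (F r) (G r)) ∧
    ∀ ρ, Tendsto (fun r => (G r).channel ρ) atTop (𝓝 (E ρ))

/-! ## States consisting of bipartite entanglement -/

open Classical in
/-- `φ` consists of bipartite entanglement: there is a simple graph `G` on the parties and, for every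
edge `{v, w}`, a bipartite pure state `χ v w` (listed for `v < w`) of `ℂ^(d v w) ⊗ ℂ^(d w v)`, the
first factor held by `v` and the second by `w`, such that `φ` is the image of the product of these
states under local isometries `U v` from `⨂ w ∼ v, ℂ^(d v w)` into the system of `v`.
(Unentangled `χ v w` are harmlessly allowed.) -/
def ConsistsOfBipartiteEntanglement {V : Type} [Fintype V] [LinearOrder V] {X : V → Type}
    [∀ v, Fintype (X v)] (φ : (∀ v, X v) → ℂ) : Prop :=
  ∃ (G : SimpleGraph V) (d : V → V → ℕ)
    (χ : (v w : V) → Fin (d v w) → Fin (d w v) → ℂ)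
    (U : (v : V) → Matrix (X v) ((w : G.neighborSet v) → Fin (d v w)) ℂ),
    (∀ v w, v < w → G.Adj v w → IsNormalized (fun p : Fin (d v w) × Fin (d w v) => χ v w p.1 p.2)) ∧
    (∀ v, (U v)ᴴ * U v = 1) ∧
    ∀ x : ∀ v, X v, φ x =
      ∑ h : (v : V) → (w : G.neighborSet v) → Fin (d v w),
        (∏ v, U v (x v) (h v)) *
          ∏ e : {e : V × V // e.1 < e.2 ∧ G.Adj e.1 e.2},
            χ e.1.1 e.1.2 (h e.1.1 ⟨e.1.2, e.2.2⟩) (h e.1.2 ⟨e.1.1, e.2.2.symm⟩)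

/-! ## The configuration of system sizes

The parties `v₁, …, v₈` are `0, …, 7 : Fin 8`. -/

/-- Dimension of the auxiliary system: a qubit for `v₁, …, v₇`, trivial for `v₈`. -/
abbrev auxDim (k : Fin 8) : ℕ := if k = 7 then 1 else 2

/-- Computational basis of the system of party `k`: a target qubit and the auxiliary system; the
dimension is `4` for `v₁, …, v₇` and `2` for `v₈`. -/
abbrev LocalBasis (k : Fin 8) : Type := Fin 2 × Fin (auxDim k)

/-- Partial trace over all the auxiliary systems. -/
def traceAux (ρ : Matrix (∀ k, LocalBasis k) (∀ k, LocalBasis k) ℂ) :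
    Matrix (Fin 8 → Fin 2) (Fin 8 → Fin 2) ℂ :=
  fun s t => ∑ a : (∀ k, Fin (auxDim k)), ρ (fun k => (s k, a k)) (fun k => (t k, a k))

/-- `φ` is a common resource state for the set `S` of states of the eight target qubits, within the
configuration of system sizes: a fully entangled state that can be transformed into every `ψ ∈ S`
by an LOCC map (chosen knowing `ψ`) on the systems of the configuration. -/
def IsCommonResourceState (φ : (∀ k, LocalBasis k) → ℂ) (S : Set ((Fin 8 → Fin 2) → ℂ)) : Prop :=
  IsNormalized φ ∧ FullyEntangled φ ∧
    ∀ ψ ∈ S, ∃ E, IsLOCCMap E ∧ traceAux (E (pureState φ)) = pureState ψ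

/-- The system-size-limited quantum state preparation in the static setting for the target set `S` is
achievable using a common resource state consisting of bipartite entanglement. -/
def AchievableByBipartiteEntanglement (S : Set ((Fin 8 → Fin 2) → ℂ)) : Prop :=
  ∃ φ : (∀ k, LocalBasis k) → ℂ, ConsistsOfBipartiteEntanglement φ ∧ IsCommonResourceState φ S

/-! ## The circuits and their output states -/

/-- The Pauli operator `Z`. -/
def pauliZ : Matrix (Fin 2) (Fin 2) ℂ := !![1, 0; 0, -1]

/-- The operator `Z ⊗ Z` on the qubits `p` and `q` (identity on the other qubits). -/
def zz (p q : Fin 8) : Matrix (Fin 8 → Fin 2) (Fin 8 → Fin 2) ℂ :=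
  localOp p pauliZ * localOp q pauliZ

/-- The gate `exp(i α Z ⊗ Z)` on the qubits `p` and `q`. -/
noncomputable def zzGate (α : ℝ) (p q : Fin 8) : Matrix (Fin 8 → Fin 2) (Fin 8 → Fin 2) ℂ :=
  NormedSpace.exp ((Complex.I * (α : ℂ)) • zz p q)

/-- The input `|+⟩^{⊗ 8}`, where `|+⟩ = (|0⟩ + |1⟩) / √2`. -/
noncomputable def plusState : (Fin 8 → Fin 2) → ℂ :=
  fun _ => ∏ _k : Fin 8, ((1 / √2 : ℝ) : ℂ)

/-- The output state of the circuit that applies to `|+⟩^{⊗ 8}` the gates `exp(i α_j Z ⊗ Z)` on the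
pairs of qubits `w j`, in the order `j = 0, …, 6`. -/
noncomputable def circuitOutput (w : Fin 7 → Fin 8 × Fin 8) (α : Fin 7 → ℝ) :
    (Fin 8 → Fin 2) → ℂ :=
  (List.finRange 7).foldl (fun ψ j => zzGate (α j) (w j).1 (w j).2 *ᵥ ψ) plusState

/-- The target set: all the output states of the circuit. -/
def targetSet (w : Fin 7 → Fin 8 × Fin 8) : Set ((Fin 8 → Fin 2) → ℂ) :=
  {ψ | ∃ α : Fin 7 → ℝ, (∀ j, α j ∈ Set.Ico 0 (2 * Real.pi)) ∧ ψ = circuitOutput w α}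

/-- The interaction graph of the circuit: one edge for each pair of qubits coupled by a gate. -/
def interactionGraph (w : Fin 7 → Fin 8 × Fin 8) : SimpleGraph (Fin 8) :=
  SimpleGraph.fromEdgeSet (Set.range fun j => s((w j).1, (w j).2))

/-- Some path starting at `v` is dominating: every vertex lies on it or is adjacent to one of its
vertices. -/
def HasDominatingPathFrom {V : Type} (G : SimpleGraph V) (v : V) : Prop :=
  ∃ (u : V) (p : G.Walk v u), p.IsPath ∧ ∀ x, ∃ y ∈ p.support, x = y ∨ G.Adj x y

/-! The small systems force the entanglement onto a line. The bond weights at a party multiply to at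
most its dimension (`ConsistsOfBipartiteEntanglement.exists_bondRank`), and full entanglement puts a
bond of weight at least 2 across every bipartition. Party `v₈`, of dimension 2, has room for one
such bond and every other party for two, so these bonds form a Hamiltonian path starting at `v₈`,
all of weight 2 (`exists_linear_layout`). Every initial segment of this path is therefore a cut of
Schmidt rank at most 2, which no LOCC branch can increase.

The circuit asks for more. Let `W` be a path of the interaction graph from `v₈` to the last vertex
of the line; every cut of the line separates the ends of `W`. Since `W` is not dominating, some edge
`xy` of the graph has neither endpoint on it. A cut of the line separating `x` from `y` is crossed
both by `xy` and by an edge of `W`, disjoint from `xy` (`exists_suffix_crossed_by_disjoint_edges`).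
Angles π/4 on these two edges and 0 elsewhere give two maximally entangled pairs across the cut, of
Schmidt rank 4.

The contradiction has to survive forgetting outcomes, tracing out the auxiliary systems and the
limit of infinitely many rounds. Hence rank is tested by a continuous linear functional of the
state, `rankWitness`: a singular 4 × 4 matrix has squared normalized overlap at most 3/4 with a
multiple of a unitary, whereas the target amplitudes are themselves such a multiple
(`not_locc_to_twoPairs`). -/

/-- `φ` has Schmidt rank at most `r` across the bipartition of the parties into `A` and `Aᶜ`. -/
def SchmidtRankLE {V : Type} {X : V → Type} (A : Set V) (r : ℕ) (φ : (∀ v, X v) → ℂ) : Prop :=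
  ∃ (f : Fin r → (∀ v : A, X v) → ℂ) (g : Fin r → (∀ v : (Aᶜ : Set V), X v) → ℂ),
    ∀ x, φ x = ∑ k, f k (fun v => x v) * g k (fun v => x v)

/-! ### Schmidt rank calculus across a fixed cut -/

namespace SchmidtRankLE

variable {V : Type} {X Y : V → Type} {A : Set V}

theorem of_fintype {ι : Type} [Fintype ι] {φ : (∀ v, X v) → ℂ}
    (f : ι → (∀ v : A, X v) → ℂ) (g : ι → (∀ v : (Aᶜ : Set V), X v) → ℂ)
    (h : ∀ x, φ x = ∑ k, f k (fun v => x v) * g k (fun v => x v)) :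
    SchmidtRankLE A (Fintype.card ι) φ := by
  refine ⟨fun k => f ((Fintype.equivFin ι).symm k), fun k => g ((Fintype.equivFin ι).symm k), ?_⟩
  intro x
  rw [h, ← (Fintype.equivFin ι).symm.sum_comp]

theorem mono {r s : ℕ} {φ : (∀ v, X v) → ℂ} (h : SchmidtRankLE A r φ) (hrs : r ≤ s) :
    SchmidtRankLE A s φ := by
  obtain ⟨t, rfl⟩ := Nat.exists_eq_add_of_le hrs
  obtain ⟨f, g, h⟩ := h
  refine ⟨Fin.append f 0, Fin.append g 0, fun x => ?_⟩
  simp [Fin.sum_univ_add, h]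

theorem mul {r s : ℕ} {φ χ : (∀ v, X v) → ℂ} (hφ : SchmidtRankLE A r φ)
    (hχ : SchmidtRankLE A s χ) : SchmidtRankLE A (r * s) (fun x => φ x * χ x) := by
  obtain ⟨f, g, hφ⟩ := hφ
  obtain ⟨f', g', hχ⟩ := hχ
  have := of_fintype (A := A) (X := X) (ι := Fin r × Fin s) (φ := fun x => φ x * χ x)
    (fun k a => f k.1 a * f' k.2 a) (fun k b => g k.1 b * g' k.2 b) (fun x => by
      simp only [hφ, hχ, Finset.sum_mul_sum, Fintype.sum_prod_type]
      exact Finset.sum_congr rfl fun i _ => Finset.sum_congr rfl fun j _ => by ring)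
  simpa using this

theorem one : SchmidtRankLE A 1 (fun _ : ∀ v, X v => (1 : ℂ)) :=
  ⟨fun _ _ => 1, fun _ _ => 1, fun _ => by simp⟩

theorem prod {ι : Type} (s : Finset ι) {r : ι → ℕ} {φ : ι → (∀ v, X v) → ℂ}
    (h : ∀ i ∈ s, SchmidtRankLE A (r i) (φ i)) :
    SchmidtRankLE A (∏ i ∈ s, r i) (fun x => ∏ i ∈ s, φ i x) := by
  classical
  induction s using Finset.induction_on with
  | empty => simpa using one
  | insert i s hi ih =>
    simp only [Finset.prod_insert hi]
    exact (h i (by simp)).mul (ih fun j hj => h j (by simp [hj]))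

/-- A product operator does not increase the Schmidt rank. -/
theorem map_prod [Fintype V] [DecidableEq V] [∀ v, Fintype (Y v)] {r : ℕ} {φ : (∀ v, Y v) → ℂ}
    (M : ∀ v, Matrix (X v) (Y v) ℂ) (h : SchmidtRankLE A r φ) :
    SchmidtRankLE A r (fun x => ∑ y, (∏ v, M v (x v) (y v)) * φ y) := by
  classical
  obtain ⟨f, g, h⟩ := h
  refine ⟨fun k a => ∑ y : ∀ v : {v // v ∈ A}, Y v, (∏ v : {v // v ∈ A}, M v (a v) (y v)) * f k y,
    fun k b => ∑ y : ∀ v : {v // v ∉ A}, Y v, (∏ v : {v // v ∉ A}, M v (b v) (y v)) * g k y,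
    fun x => ?_⟩
  beta_reduce
  -- The sum over `y` splits into independent sums over the coordinates in `A` and those outside,
  -- and the product operator factors accordingly.
  rw [← (Equiv.piEquivPiSubtypeProd (fun v => v ∈ A) Y).symm.sum_comp]
  simp only [h, Fintype.sum_prod_type, Finset.sum_mul_sum]
  simp only [Finset.mul_sum]
  conv_rhs => rw [Finset.sum_comm]
  refine Finset.sum_congr rfl fun y _ => ?_
  conv_rhs => rw [Finset.sum_comm]
  refine Finset.sum_congr rfl fun z _ => Finset.sum_congr rfl fun k _ => ?_
  rw [← Fintype.prod_subtype_mul_prod_subtype (fun v => v ∈ A)]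
  have hA : ∀ v : {v // v ∈ A},
      (Equiv.piEquivPiSubtypeProd (fun v => v ∈ A) Y).symm (y, z) v = y v := fun v => by
    simp [Equiv.piEquivPiSubtypeProd_symm_apply]
  have hB : ∀ v : {v // v ∉ A},
      (Equiv.piEquivPiSubtypeProd (fun v => v ∈ A) Y).symm (y, z) v = z v := fun v => by
    simp [Equiv.piEquivPiSubtypeProd_symm_apply, v.2]
  have hf : (fun v : A => (Equiv.piEquivPiSubtypeProd (fun v => v ∈ A) Y).symm (y, z) v) = y :=
    funext hA
  have hg : (fun v : (Aᶜ : Set V) =>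
      (Equiv.piEquivPiSubtypeProd (fun v => v ∈ A) Y).symm (y, z) v) = z := funext hB
  rw [hf, hg]
  simp only [hA, hB]
  ring

/-- Expanding over the `d` values of `p (x a)` with indicator functions costs one product term per
value. -/
theorem edge_left {a b : V} {d : ℕ} {β : Type} (ha : a ∈ A) (hb : b ∉ A) (F : Fin d → β → ℂ)
    (p : X a → Fin d) (q : X b → β) : SchmidtRankLE A d (fun x => F (p (x a)) (q (x b))) := by
  refine ⟨fun k x => if p (x ⟨a, ha⟩) = k then 1 else 0, fun k x => F k (q (x ⟨b, hb⟩)), fun x => ?_⟩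
  simp

theorem edge_right {a b : V} {d : ℕ} {β : Type} (ha : a ∉ A) (hb : b ∈ A) (F : Fin d → β → ℂ)
    (p : X a → Fin d) (q : X b → β) : SchmidtRankLE A d (fun x => F (p (x a)) (q (x b))) := by
  refine ⟨fun k x => F k (q (x ⟨b, hb⟩)), fun k x => if p (x ⟨a, ha⟩) = k then 1 else 0, fun x => ?_⟩
  simp

theorem edge_inside {a b : V} (ha : a ∈ A) (hb : b ∈ A) (F : X a → X b → ℂ) :
    SchmidtRankLE A 1 (fun x : ∀ v, X v => F (x a) (x b)) :=
  ⟨fun _ x => F (x ⟨a, ha⟩) (x ⟨b, hb⟩), fun _ _ => 1, fun x => by simp⟩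

theorem edge_outside {a b : V} (ha : a ∉ A) (hb : b ∉ A) (F : X a → X b → ℂ) :
    SchmidtRankLE A 1 (fun x : ∀ v, X v => F (x a) (x b)) :=
  ⟨fun _ _ => 1, fun _ x => F (x ⟨a, ha⟩) (x ⟨b, hb⟩), fun x => by simp⟩

-- A crossing edge can be expanded over the values at either end, hence the minimum; the indicator
-- sits on whichever side has the smaller dimension.
open Classical in
theorem edge {a b : V} {d d' : ℕ} (F : Fin d → Fin d' → ℂ)
    (p : X a → Fin d) (q : X b → Fin d') :
    SchmidtRankLE A (if (a ∈ A ↔ b ∈ A) then 1 else min d d')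
      (fun x => F (p (x a)) (q (x b))) := by
  by_cases ha : a ∈ A <;> by_cases hb : b ∈ A <;> simp only [ha, hb, iff_true, iff_false, not_true_eq_false,
    if_true, if_false]
  · exact edge_inside ha hb (fun s t => F (p s) (q t))
  · rcases min_choice d d' with h | h <;> rw [h]
    · exact edge_left ha hb F p q
    · exact edge_right hb ha (fun t s => F s t) q p
  · rcases min_choice d d' with h | h <;> rw [h]
    · exact edge_right ha hb F p q
    · exact edge_left hb ha (fun t s => F s t) q p
  · exact edge_outside ha hb (fun s t => F (p s) (q t))

end SchmidtRankLE

/-! ### Bond weights of a state consisting of bipartite entanglement -/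

theorem card_le_card_of_conjTranspose_mul_self_eq_one {m n : Type} [Fintype m] [Fintype n]
    [DecidableEq n] {U : Matrix m n ℂ} (h : Uᴴ * U = 1) : Fintype.card n ≤ Fintype.card m := by
  have h1 : (Uᴴ * U).rank = Fintype.card n := by rw [h, Matrix.rank_one]
  exact h1 ▸ (Matrix.rank_mul_le_right _ _).trans (Matrix.rank_le_card_height U)

/-- The Schmidt ranks `m v w` of the bipartite states composing a state consisting of bipartite
entanglement are limited by the dimensions of the parties, and limit its Schmidt ranks. -/
theorem ConsistsOfBipartiteEntanglement.exists_bondRank {V : Type} [Fintype V] [LinearOrder V]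
    {X : V → Type} [∀ v, Fintype (X v)] {φ : (∀ v, X v) → ℂ}
    (hφ : ConsistsOfBipartiteEntanglement φ) :
    ∃ m : V → V → ℕ, (∀ v w, m v w = m w v) ∧
      (∀ v (s : Finset V), ∏ w ∈ s, m v w ≤ Fintype.card (X v)) ∧
      (∀ A : Set V, (∀ v ∈ A, ∀ w ∉ A, m v w < 2) → SchmidtRankLE A 1 φ) ∧
      ∀ A : Set V, ∀ v ∈ A, ∀ w ∉ A, 2 ≤ m v w →
        (∀ v' ∈ A, ∀ w' ∉ A, 2 ≤ m v' w' → v' = v ∧ w' = w) → SchmidtRankLE A (m v w) φ := by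
  classical
  obtain ⟨G, d, χ, U, hχ, hU, hφ⟩ := hφ
  -- Normalization excludes empty index sets on edges. Weights are then at least 1, so a product
  -- over some neighbours is bounded by the product over all, and a weight below 2 equals 1.
  have hd : ∀ v w, G.Adj v w → 1 ≤ d v w := by
    have key : ∀ v w, v < w → G.Adj v w → 1 ≤ d v w ∧ 1 ≤ d w v := by
      intro v w hvw hG
      have h := hχ v w hvw hG
      by_contra hlt
      have : IsEmpty (Fin (d v w) × Fin (d w v)) := by
        refine ⟨fun p => hlt ⟨?_, ?_⟩⟩
        · exact Nat.one_le_iff_ne_zero.2 fun h0 => (h0 ▸ p.1).elim0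
        · exact Nat.one_le_iff_ne_zero.2 fun h0 => (h0 ▸ p.2).elim0
      simp [IsNormalized] at h
    intro v w hG
    rcases lt_or_gt_of_ne hG.ne with h | h
    · exact (key v w h hG).1
    · exact (key w v h hG.symm).2
  -- The smaller local dimension replaces the exact Schmidt rank of `χ v w`: it bounds that rank,
  -- and is at most the factor dimension at both ends.
  let m : V → V → ℕ := fun v w => if G.Adj v w then min (d v w) (d w v) else 1
  have hsymm : ∀ v w, m v w = m w v := fun v w => by
    simp only [m, G.adj_comm v w, min_comm (d v w)]
  have hpos : ∀ v w, 1 ≤ m v w := fun v w => by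
    by_cases h : G.Adj v w
    · simpa [m, h] using ⟨hd v w h, hd w v h.symm⟩
    · simp [m, h]
  have hadj : ∀ v w, G.Adj v w → m v w = min (d v w) (d w v) := fun v w h => by simp [m, h]
  have hcut : ∀ A : Set V, SchmidtRankLE A
      (∏ e : {e : V × V // e.1 < e.2 ∧ G.Adj e.1 e.2},
        if (e.1.1 ∈ A ↔ e.1.2 ∈ A) then 1 else m e.1.1 e.1.2) φ := by
    intro A
    have hedge : ∀ e : {e : V × V // e.1 < e.2 ∧ G.Adj e.1 e.2},
        SchmidtRankLE (X := fun v => (w : G.neighborSet v) → Fin (d v w)) A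
          (if (e.1.1 ∈ A ↔ e.1.2 ∈ A) then 1 else m e.1.1 e.1.2)
          (fun h => χ e.1.1 e.1.2 (h e.1.1 ⟨e.1.2, e.2.2⟩) (h e.1.2 ⟨e.1.1, e.2.2.symm⟩)) := by
      intro e
      rw [hadj _ _ e.2.2]
      exact SchmidtRankLE.edge (X := fun v => (w : G.neighborSet v) → Fin (d v w))
        (χ e.1.1 e.1.2) (fun h => h ⟨e.1.2, e.2.2⟩) (fun h => h ⟨e.1.1, e.2.2.symm⟩)
    have h := SchmidtRankLE.map_prod U (SchmidtRankLE.prod Finset.univ fun e _ => hedge e)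
    rw [show φ = _ from funext hφ]
    exact h
  refine ⟨m, hsymm, fun v s => ?_, fun A hA => ?_, fun A v hv w hw hm huniq => ?_⟩
  · calc ∏ w ∈ s, m v w ≤ ∏ w, m v w :=
        Finset.prod_le_prod_of_subset_of_one_le' (Finset.subset_univ s) fun w _ _ => hpos v w
      _ = ∏ w : G.neighborSet v, m v w := by
        rw [← Fintype.prod_subtype_mul_prod_subtype (fun w => w ∈ G.neighborSet v)]
        rw [Finset.prod_eq_one (f := fun w : {w // w ∉ G.neighborSet v} => m v w), mul_one]
        intro w _
        have := w.2
        simp only [SimpleGraph.mem_neighborSet] at this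
        simp [m, this]
      _ ≤ ∏ w : G.neighborSet v, d v w := Finset.prod_le_prod' fun w _ => by
        rw [hadj v w w.2]; exact min_le_left _ _
      _ = Fintype.card ((w : G.neighborSet v) → Fin (d v w)) := by simp
      _ ≤ _ := card_le_card_of_conjTranspose_mul_self_eq_one (hU v)
  · have h := hcut A
    rwa [Finset.prod_eq_one] at h
    intro e _
    split_ifs with he
    · rfl
    · have h1 := hpos e.1.1 e.1.2
      by_cases h2 : e.1.1 ∈ A
      · have := hA _ h2 e.1.2 (by tauto); omega
      · have := hA e.1.2 (by tauto) _ h2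
        rw [hsymm] at this; omega
  · have hG : G.Adj v w := by
      by_contra h
      simp [m, h] at hm
    have hother : ∀ e : {e : V × V // e.1 < e.2 ∧ G.Adj e.1 e.2},
        ¬ (e.1.1 = v ∧ e.1.2 = w) → ¬ (e.1.1 = w ∧ e.1.2 = v) →
        (if (e.1.1 ∈ A ↔ e.1.2 ∈ A) then 1 else m e.1.1 e.1.2) = 1 := by
      intro e h1 h2
      split_ifs with he
      · rfl
      · have h3 := hpos e.1.1 e.1.2
        by_contra h4
        by_cases h5 : e.1.1 ∈ A
        · exact h1 (huniq _ h5 e.1.2 (by tauto) (by omega))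
        · exact h2 (huniq e.1.2 (by tauto) _ h5 (by rw [hsymm]; omega)).symm
    have h := hcut A
    -- Edges are listed in increasing order, so the only nontrivial factor sits at `(v, w)` or at
    -- `(w, v)`.
    rcases lt_or_gt_of_ne hG.ne with hlt | hlt
    · rw [Fintype.prod_eq_single ⟨(v, w), hlt, hG⟩] at h
      · simpa [hv, hw] using h
      · intro e he
        refine hother e (fun h => he (Subtype.ext (Prod.ext h.1 h.2))) fun h => ?_
        have := e.2.1
        rw [h.1, h.2] at this
        exact lt_asymm this hlt
    · rw [Fintype.prod_eq_single ⟨(w, v), hlt, hG.symm⟩] at h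
      · simpa [hv, hw, hsymm w v] using h
      · intro e he
        refine hother e (fun h => ?_) fun h => he (Subtype.ext (Prod.ext h.1 h.2))
        have := e.2.1
        rw [h.1, h.2] at this
        exact lt_asymm this hlt

theorem FullyEntangled.not_schmidtRankLE_one {V : Type} {X : V → Type} {φ : (∀ v, X v) → ℂ}
    (h : FullyEntangled φ) {A : Set V} (hA : A.Nonempty) (hA' : Aᶜ.Nonempty) :
    ¬ SchmidtRankLE A 1 φ := fun ⟨f, g, hfg⟩ =>
  h A hA hA' ⟨f 0, g 0, fun x => by simpa using hfg x⟩

/-! ### Linear layouts and the cuts they force -/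

/-- Greedy construction of a linear layout: the weighted graph `m` is connected and has too little
capacity at each vertex to branch, so that it is a path starting at `r`. -/
theorem exists_linear_layout {V : Type} [Fintype V] [DecidableEq V] (r : V) (m : V → V → ℕ)
    (hsymm : ∀ v w, m v w = m w v) (hdeg : ∀ v (s : Finset V), ∏ w ∈ s, m v w ≤ 4)
    (hroot : ∀ s : Finset V, ∏ w ∈ s, m r w ≤ 2)
    (hconn : ∀ A : Set V, A.Nonempty → Aᶜ.Nonempty → ∃ v ∈ A, ∃ w ∉ A, 2 ≤ m v w)
    (P : Set V → Prop)
    (hP : ∀ A : Set V, ∀ v ∈ A, ∀ w ∉ A, 2 ≤ m v w → m v w ≤ 2 →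
      (∀ v' ∈ A, ∀ w' ∉ A, 2 ≤ m v' w' → v' = v ∧ w' = w) → P A) :
    ∃ l : List V, l.Nodup ∧ (∀ v, v ∈ l) ∧
      ∀ s, s <:+ l → s ≠ [] → r ∈ s ∧ (s ≠ l → P {v | v ∈ s}) := by
  -- The line grows at the head of the list, so its initial segments are the suffixes. Invariant:
  -- only the newest vertex `u` may still have heavy bonds (weight at least 2) leaving the list.
  have step : ∀ k < Fintype.card V, ∃ (u : V) (t : List V), (u :: t).length = k + 1 ∧
      (u :: t).Nodup ∧ (t = [] → u = r) ∧ (t ≠ [] → ∃ y ∈ t, 2 ≤ m u y) ∧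
      (∀ v ∈ t, ∀ w, 2 ≤ m v w → w ∈ u :: t) ∧
      ∀ s, s <:+ u :: t → s ≠ [] → r ∈ s ∧ (s ≠ u :: t → P {v | v ∈ s}) := by
    intro k hk
    induction k with
    | zero =>
      refine ⟨r, [], by simp, by simp, by simp, by simp, by simp, fun s hs hne => ?_⟩
      rcases List.suffix_cons_iff.1 hs with rfl | hs
      · simp
      · exact absurd (List.suffix_nil.1 hs) hne
    | succ k ih =>
      obtain ⟨u, t, hlen, hnodup, hu, hu', ht, hs⟩ := ih (by omega)
      have hcompl : ({v | v ∈ u :: t}ᶜ : Set V).Nonempty := by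
        by_contra hempty
        have hall : ∀ v, v ∈ (u :: t).toFinset := fun v => by
          by_contra hv
          exact hempty ⟨v, fun h => hv (List.mem_toFinset.2 h)⟩
        have h1 := Finset.card_le_card (fun v _ => hall v : (Finset.univ : Finset V) ⊆ _)
        have h2 := List.toFinset_card_le (u :: t)
        rw [Finset.card_univ] at h1
        omega
      obtain ⟨v, hv, x, hx, hvx⟩ := hconn {v | v ∈ u :: t} ⟨u, by simp⟩ hcompl
      have hout : ∀ v' ∈ u :: t, ∀ x' ∉ u :: t, 2 ≤ m v' x' → v' = u := by
        intro v' hv' x' hx' hm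
        rcases List.mem_cons.1 hv' with h | h
        · exact h
        · exact absurd (ht v' h x' hm) hx'
      obtain rfl : v = u := hout v hv x hx hvx
      have hx : x ∉ v :: t := hx
      -- The bond to `x` exhausts the capacity of `v`: 2 at the root, and otherwise 4, of which the
      -- bond back to `y ∈ t` already takes a factor at least 2. This caps `m v x` at 2 and leaves
      -- no third heavy bond.
      have hnb : m v x ≤ 2 ∧ ∀ w, 2 ≤ m v w → w ∈ x :: v :: t := by
        by_cases hnil : t = []
        · obtain rfl := hu hnil
          refine ⟨by simpa using hroot {x}, fun w hw => ?_⟩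
          by_contra hwx
          have hne : x ≠ w := fun h => hwx (by simp [h])
          have := hroot {x, w}
          rw [Finset.prod_pair hne] at this
          nlinarith
        · obtain ⟨y, hy, hvy⟩ := hu' hnil
          have hyx : y ≠ x := fun h => hx (by simp [← h, hy])
          refine ⟨?_, fun w hw => ?_⟩
          · have := hdeg v {y, x}
            rw [Finset.prod_pair hyx] at this
            nlinarith
          · by_contra hwx
            have h1 : x ≠ w := fun h => hwx (by simp [h])
            have h2 : y ≠ w := fun h => hwx (by simp [← h, hy])
            have := hdeg v {y, x, w}
            rw [Finset.prod_insert (by simp [hyx, h2]), Finset.prod_pair h1] at this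
            have h3 : 2 * (2 * 2) ≤ m v y * (m v x * m v w) :=
              Nat.mul_le_mul hvy (Nat.mul_le_mul hvx hw)
            omega
      refine ⟨x, v :: t, by simpa using hlen, List.nodup_cons.2 ⟨hx, hnodup⟩, by simp,
        fun _ => ⟨v, by simp, by rwa [hsymm]⟩, ?_, fun s hsuf hne => ?_⟩
      · intro v' hv' w hw
        rcases List.mem_cons.1 hv' with rfl | h
        · exact hnb.2 w hw
        · exact List.mem_cons_of_mem _ (ht v' h w hw)
      · rcases List.suffix_cons_iff.1 hsuf with rfl | hsuf
        · exact ⟨List.mem_cons_of_mem _ (hs _ List.suffix_rfl (by simp)).1, fun h => absurd rfl h⟩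
        · refine ⟨(hs s hsuf hne).1, fun _ => ?_⟩
          by_cases h : s = v :: t
          · subst h
            refine hP _ v (by simp) x hx hvx hnb.1 fun v' hv' w' hw' hm => ?_
            obtain rfl := hout v' hv' w' hw' hm
            refine ⟨rfl, ?_⟩
            rcases List.mem_cons.1 (hnb.2 w' hm) with h | h
            · exact h
            · exact absurd h hw'
          · exact (hs s hsuf hne).2 h
  obtain ⟨u, t, hlen, hnodup, -, -, -, hs⟩ :=
    step (Fintype.card V - 1) (Nat.sub_lt (Fintype.card_pos_iff.2 ⟨r⟩) one_pos)
  refine ⟨u :: t, hnodup, fun v => ?_, hs⟩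
  have hcard : (u :: t).toFinset.card = Fintype.card V := by
    rw [List.toFinset_card_of_nodup hnodup, hlen]
    exact Nat.sub_add_cancel (Fintype.card_pos_iff.2 ⟨r⟩)
  exact List.mem_toFinset.1 (Finset.eq_univ_iff_forall.1 (Finset.card_eq_iff_eq_univ _ |>.1 hcard) v)

/-- The tail just after whichever of `x`, `y` occurs first contains the other one only. -/
theorem List.Nodup.exists_suffix_separating {α : Type} {l : List α} (hl : l.Nodup) {x y : α}
    (hx : x ∈ l) (hy : y ∈ l) (hxy : x ≠ y) :
    ∃ s, s <:+ l ∧ s ≠ [] ∧ s ≠ l ∧ ((x ∈ s ∧ y ∉ s) ∨ (y ∈ s ∧ x ∉ s)) := by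
  induction l with
  | nil => simp at hx
  | cons a t ih =>
    have hat := (List.nodup_cons.1 hl).1
    have hne : t ≠ a :: t := fun h => by simpa using congrArg List.length h
    rcases List.mem_cons.1 hx with rfl | hx'
    · have hy' : y ∈ t := (List.mem_cons.1 hy).resolve_left (Ne.symm hxy)
      exact ⟨t, List.suffix_cons x t, List.ne_nil_of_mem hy', hne, .inr ⟨hy', hat⟩⟩
    rcases List.mem_cons.1 hy with rfl | hy'
    · exact ⟨t, List.suffix_cons y t, List.ne_nil_of_mem hx', hne, .inl ⟨hx', hat⟩⟩
    obtain ⟨s, hs, hnil, -, h⟩ := ih (List.nodup_cons.1 hl).2 hx' hy'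
    refine ⟨s, hs.trans (List.suffix_cons a t), hnil, fun h' => ?_, h⟩
    have := hs.length_le
    simp [h'] at this

/-- If no path starting at `r` is dominating, then every linear layout starting at `r` has a cut
that is crossed by two disjoint edges. -/
theorem exists_suffix_crossed_by_disjoint_edges {V : Type} {G : SimpleGraph V}
    (hG : G.Connected) {r : V} (hr : ¬ HasDominatingPathFrom G r) {l : List V} (hl : l.Nodup)
    (hmem : ∀ v, v ∈ l) (hroot : ∀ s, s <:+ l → s ≠ [] → r ∈ s) :
    ∃ s, s <:+ l ∧ s ≠ [] ∧ s ≠ l ∧ ∃ p x q y, p ∈ s ∧ x ∈ s ∧ q ∉ s ∧ y ∉ s ∧ p ≠ x ∧ q ≠ y ∧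
      G.Adj p q ∧ G.Adj x y := by
  classical
  obtain ⟨h, t, rfl⟩ := List.exists_cons_of_ne_nil (List.ne_nil_of_mem (hmem r))
  -- The head `h` is the last vertex of the line: every proper nonempty suffix contains `r` but not
  -- `h`, so `W` crosses every cut.
  obtain ⟨W, hW⟩ := (hG.preconnected r h).exists_isPath
  have hdom : ∃ x, ∀ z ∈ W.support, x ≠ z ∧ ¬ G.Adj x z := by
    by_contra hcon
    push Not at hcon
    refine hr ⟨h, W, hW, fun x => ?_⟩
    obtain ⟨z, hz, hxz⟩ := hcon x
    exact ⟨z, hz, or_iff_not_imp_left.2 hxz⟩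
  obtain ⟨x, hx⟩ := hdom
  have hxr : x ≠ r := (hx r W.start_mem_support).1
  have : Nontrivial V := ⟨x, r, hxr⟩
  obtain ⟨y, hxy⟩ := hG.preconnected.exists_adj_of_nontrivial x
  have hy : ∀ z ∈ W.support, y ≠ z := fun z hz hyz => (hx z hz).2 (hyz ▸ hxy)
  obtain ⟨s, hs, hnil, hne, hsep⟩ := hl.exists_suffix_separating (hmem x) (hmem y) hxy.ne
  have hhs : h ∉ s := by
    rcases List.suffix_cons_iff.1 hs with h' | h'
    · exact absurd h' hne
    · exact fun hh => (List.nodup_cons.1 hl).1 (h'.mem hh)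
  obtain ⟨e, he, hp, hq⟩ := W.exists_boundary_dart {v | v ∈ s} (hroot s hs hnil) hhs
  have hps := W.dart_fst_mem_support_of_mem_darts he
  have hqs := W.dart_snd_mem_support_of_mem_darts he
  refine ⟨s, hs, hnil, hne, ?_⟩
  rcases hsep with ⟨h1, h2⟩ | ⟨h1, h2⟩
  · exact ⟨e.fst, x, e.snd, y, hp, h1, hq, h2, (hx _ hps).1.symm, (hy _ hqs).symm, e.adj, hxy⟩
  · exact ⟨e.fst, y, e.snd, x, hp, h1, hq, h2, (hy _ hps).symm, (hx _ hqs).1.symm, e.adj, hxy.symm⟩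

/-! ### Overlap of low-rank vectors with two maximally entangled pairs -/

/-- The amplitudes, up to normalization, of the state `exp(i π/4 Z⊗Z) |++⟩` of two qubits. -/
noncomputable def pairAmp (a b : Fin 2) : ℂ :=
  Complex.exp (Complex.I * (Real.pi / 4 : ℝ) * (pauliZ a a * pauliZ b b))

theorem norm_pairAmp (a b : Fin 2) : ‖pairAmp a b‖ = 1 := by
  have : ∃ t : ℝ, pairAmp a b = Complex.exp (t * Complex.I) := by
    refine ⟨Real.pi / 4 * ((if a = 0 then 1 else -1) * (if b = 0 then 1 else -1)), ?_⟩
    unfold pairAmp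
    congr 1
    fin_cases a <;> fin_cases b <;> simp [pauliZ] <;> ring
  obtain ⟨t, ht⟩ := this
  rw [ht, Complex.norm_exp_ofReal_mul_I]

theorem pairAmp_eq (a b : Fin 2) :
    pairAmp a b = (1 + (if a = b then 1 else -1) * Complex.I) * ((√2 / 2 : ℝ) : ℂ) := by
  have h : ∀ s : ℂ, (s = 1 ∨ s = -1) → Complex.exp (Complex.I * (Real.pi / 4 : ℝ) * s)
      = (1 + s * Complex.I) * ((√2 / 2 : ℝ) : ℂ) := by
    intro s hs
    have h1 : Complex.cos ((Real.pi / 4 : ℝ) : ℂ) = ((√2 / 2 : ℝ) : ℂ) := by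
      rw [← Complex.ofReal_cos, Real.cos_pi_div_four]
    have h2 : Complex.sin ((Real.pi / 4 : ℝ) : ℂ) = ((√2 / 2 : ℝ) : ℂ) := by
      rw [← Complex.ofReal_sin, Real.sin_pi_div_four]
    rcases hs with rfl | rfl
    · rw [mul_one, mul_comm, Complex.exp_mul_I, h1, h2]; ring
    · rw [show Complex.I * ((Real.pi / 4 : ℝ) : ℂ) * -1 = (-((Real.pi / 4 : ℝ) : ℂ)) * Complex.I by ring,
        Complex.exp_mul_I, Complex.cos_neg, Complex.sin_neg, h1, h2]; ring
  unfold pairAmp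
  rw [h _ (by fin_cases a <;> fin_cases b <;> simp [pauliZ])]
  fin_cases a <;> fin_cases b <;> simp [pauliZ]

/-- The columns of the `4 × 4` matrix of `pairAmp ⊗ pairAmp` are orthogonal. -/
theorem sum_pairAmp_mul (b b' : Fin 2) :
    ∑ a, star (pairAmp a b) * pairAmp a b' = if b = b' then 2 else 0 := by
  have h2 : ((√2 / 2 : ℝ) : ℂ) * ((√2 / 2 : ℝ) : ℂ) = 1 / 2 := by
    rw [← Complex.ofReal_mul, show √2 / 2 * (√2 / 2) = 1 / 2 by
      rw [div_mul_div_comm, Real.mul_self_sqrt (by norm_num)]; norm_num]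
    norm_num
  have hI := Complex.I_mul_I
  simp only [pairAmp_eq, Fin.sum_univ_two, Complex.star_def, map_mul, map_add, map_one,
    Complex.conj_ofReal, Complex.conj_I]
  generalize ((√2 / 2 : ℝ) : ℂ) = c at h2
  fin_cases b <;> fin_cases b' <;> simp
  · linear_combination (2 * (1 - Complex.I * Complex.I)) * h2 - hI
  · linear_combination (2 * c * c) * hI
  · linear_combination (2 * c * c) * hI
  · linear_combination (2 * (1 - Complex.I * Complex.I)) * h2 - hI

theorem norm_trace_conjTranspose_mul_sq_le {n : Type} [Fintype n] (A B : Matrix n n ℂ) :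
    ‖(Aᴴ * B).trace‖ ^ 2 ≤ (∑ i, ∑ j, ‖A i j‖ ^ 2) * ∑ i, ∑ j, ‖B i j‖ ^ 2 := by
  have h : (Aᴴ * B).trace = ∑ p : n × n, star (A p.1 p.2) * B p.1 p.2 := by
    simp only [Matrix.trace, Matrix.diag, Matrix.mul_apply, Matrix.conjTranspose_apply,
      Fintype.sum_prod_type]
    exact Finset.sum_comm
  simp only [h, ← Fintype.sum_prod_type']
  calc _ ≤ (∑ p : n × n, ‖A p.1 p.2‖ * ‖B p.1 p.2‖) ^ 2 := by
        gcongr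
        exact (norm_sum_le _ _).trans_eq (by simp)
    _ ≤ _ := Finset.sum_mul_sq_le_sq_mul_sq _ _ _

theorem trace_conjTranspose_mul_self_eq {n : Type} [Fintype n] (A : Matrix n n ℂ) :
    (Aᴴ * A).trace = ((∑ i, ∑ j, ‖A i j‖ ^ 2 : ℝ) : ℂ) := by
  simp only [Matrix.trace, Matrix.diag, Matrix.mul_apply, Matrix.conjTranspose_apply]
  rw [Finset.sum_comm]
  simp [Complex.conj_mul']

/-- A singular matrix has a bounded overlap with a multiple of a unitary matrix. -/
theorem norm_trace_sq_le_of_mulVec_eq_zero {n : Type} [Fintype n] [DecidableEq n]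
    {Ψ Ξ : Matrix n n ℂ} {c : ℝ} (hΨ : Ψᴴ * Ψ = (c : ℂ) • 1) {v : n → ℂ} (hv : v ≠ 0)
    (hΞ : Ξ *ᵥ v = 0) :
    ‖(Ψᴴ * Ξ).trace‖ ^ 2 ≤ c * (Fintype.card n - 1) * ∑ i, ∑ j, ‖Ξ i j‖ ^ 2 := by
  set N : ℝ := ∑ i, ‖v i‖ ^ 2 with hN
  have hNpos : 0 < N := by
    obtain ⟨i, hi⟩ := Function.ne_iff.1 hv
    exact Finset.sum_pos' (fun _ _ => by positivity) ⟨i, Finset.mem_univ _, by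
      have : 0 < ‖v i‖ := norm_pos_iff.2 hi
      positivity⟩
  have hvv : star v ⬝ᵥ v = (N : ℂ) := by simp [dotProduct, hN, Complex.conj_mul']
  set R : Matrix n n ℂ := Matrix.vecMulVec v (star v) with hR
  have hRR : R * R = (N : ℂ) • R := by
    rw [hR, Matrix.vecMulVec_mul_vecMulVec, hvv]
    ext i j; simp [Matrix.vecMulVec_apply]; ring
  have hRh : Rᴴ = R := by
    rw [hR, Matrix.conjTranspose_vecMulVec, star_star]
  have hRt : R.trace = N := by
    rw [hR, Matrix.trace_vecMulVec, dotProduct_comm, hvv]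
  have hΞR : Ξ * R = 0 := by rw [hR, Matrix.mul_vecMulVec, hΞ, Matrix.zero_vecMulVec]
  -- `Q` is `N` times the projection orthogonal to `v`. Since `Ξ` kills `v`, `Ψ` may be replaced by
  -- `Ψ * Q` in the overlap before Cauchy–Schwarz; the lost direction turns the dimension into
  -- dimension minus 1.
  set Q : Matrix n n ℂ := (N : ℂ) • 1 - R with hQ
  have hQh : Qᴴ = Q := by simp [hQ, hRh]
  have hQQ : Q * Q = (N : ℂ) • Q := by
    simp only [hQ, sub_mul, mul_sub, smul_mul_assoc, mul_smul_comm, one_mul, mul_one, hRR, smul_sub]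
    abel
  have hΞQ : Ξ * Q = (N : ℂ) • Ξ := by simp [hQ, mul_sub, hΞR]
  have h1 : ((Ψ * Q)ᴴ * Ξ).trace = N * (Ψᴴ * Ξ).trace := by
    rw [Matrix.conjTranspose_mul, hQh, Matrix.mul_assoc, Matrix.trace_mul_comm, Matrix.mul_assoc,
      hΞQ, Matrix.mul_smul, Matrix.trace_smul, smul_eq_mul]
  have h2 : (∑ i, ∑ j, ‖(Ψ * Q) i j‖ ^ 2 : ℝ) = N ^ 2 * (c * (Fintype.card n - 1)) := by
    apply Complex.ofReal_injective
    rw [← trace_conjTranspose_mul_self_eq, Matrix.conjTranspose_mul, hQh, Matrix.mul_assoc,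
      ← Matrix.mul_assoc Ψᴴ, hΨ, Matrix.smul_mul, one_mul, Matrix.mul_smul, hQQ]
    simp only [Matrix.trace_smul, hQ, Matrix.trace_sub, Matrix.trace_one, hRt, smul_eq_mul]
    push_cast
    ring
  have h3 := norm_trace_conjTranspose_mul_sq_le (Ψ * Q) Ξ
  rw [h1, h2, norm_mul, Complex.norm_real, Real.norm_of_nonneg hNpos.le, mul_pow, mul_assoc] at h3
  exact le_of_mul_le_mul_left h3 (by positivity)

/-- The amplitudes, up to normalization, of two pairs of qubits in the state of `pairAmp`, as a
matrix whose rows belong to the first qubits and whose columns belong to the second qubits. -/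
noncomputable def twoPairs : Matrix (Fin 2 × Fin 2) (Fin 2 × Fin 2) ℂ :=
  fun a b => pairAmp a.1 b.1 * pairAmp a.2 b.2

theorem twoPairs_conjTranspose_mul_self : twoPairsᴴ * twoPairs = ((4 : ℝ) : ℂ) • 1 := by
  ext b b'
  have : (twoPairsᴴ * twoPairs) b b' = (∑ a, star (pairAmp a b.1) * pairAmp a b'.1) *
      ∑ a, star (pairAmp a b.2) * pairAmp a b'.2 := by
    simp only [Matrix.mul_apply, Matrix.conjTranspose_apply, twoPairs, Finset.sum_mul_sum,
      Fintype.sum_prod_type, star_mul']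
    exact Finset.sum_congr rfl fun _ _ => Finset.sum_congr rfl fun _ _ => by ring
  rw [this, sum_pairAmp_mul, sum_pairAmp_mul]
  by_cases h1 : b.1 = b'.1 <;> by_cases h2 : b.2 = b'.2 <;>
    simp [h1, h2, Matrix.one_apply, Prod.ext_iff]
  norm_num

/-- Two functionals on a 4-dimensional space have a common zero, so `Ξ` is singular. The constant is
12 = 4 · (4 − 1), with 4 from `twoPairs_conjTranspose_mul_self`. -/
theorem norm_trace_twoPairs_sq_le (Ξ : Matrix (Fin 2 × Fin 2) (Fin 2 × Fin 2) ℂ)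
    (f g : Fin 2 → Fin 2 × Fin 2 → ℂ) (h : ∀ a b, Ξ a b = ∑ k, f k a * g k b) :
    ‖(twoPairsᴴ * Ξ).trace‖ ^ 2 ≤ 12 * ∑ i, ∑ j, ‖Ξ i j‖ ^ 2 := by
  obtain ⟨v, hv, hv0⟩ := Submodule.exists_mem_ne_zero_of_ne_bot
    (LinearMap.ker_ne_bot_of_finrank_lt (f := Matrix.mulVecLin (Matrix.of g)) (by simp))
  have hg : ∀ k, ∑ b, g k b * v b = 0 := fun k => congrFun (LinearMap.mem_ker.1 hv) k
  have hΞ : Ξ *ᵥ v = 0 := by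
    ext a
    simp only [Matrix.mulVec, dotProduct, h, Finset.sum_mul]
    rw [Finset.sum_comm]
    simp [mul_assoc, ← Finset.mul_sum, hg]
  have := norm_trace_sq_le_of_mulVec_eq_zero twoPairs_conjTranspose_mul_self hv0 hΞ
  norm_num at this
  exact this

/-! ### LOCC branches and the rank witness -/

theorem SchmidtRankLE.tensorOp_mulVec {V : Type} [Fintype V] [DecidableEq V] {X : V → Type} [∀ v, Fintype (X v)]
    {A : Set V} {r : ℕ} {φ : (∀ v, X v) → ℂ} (M : ∀ v, Matrix (X v) (X v) ℂ)
    (h : SchmidtRankLE A r φ) : SchmidtRankLE A r (tensorOp M *ᵥ φ) :=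
  h.map_prod M

/-- Every branch of an LOCC protocol does not increase the Schmidt rank. -/
theorem schmidtRankLE_of_locc {V : Type} [Fintype V] [DecidableEq V] {X : V → Type}
    [∀ v, Fintype (X v)] [∀ v, DecidableEq (X v)] {F G : ℕ → OpFamily X}
    (h0 : F 0 = OpFamily.trivial) (hF : ∀ r, LOCCLinked (F r) (F (r + 1)))
    (hG : ∀ r, LocallyCorrected (F r) (G r)) {A : Set V} {k : ℕ} {φ : (∀ v, X v) → ℂ}
    (hφ : SchmidtRankLE A k φ) (r : ℕ) (i : (G r).Outcome) :
    SchmidtRankLE A k ((G r).op i *ᵥ φ) := by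
  have key : ∀ r i, SchmidtRankLE A k ((F r).op i *ᵥ φ) := by
    intro r
    induction r with
    | zero =>
      rw [h0]
      intro i
      simpa [OpFamily.trivial] using hφ
    | succ r ih =>
      obtain ⟨v, n, M, e, -, h⟩ := hF r
      intro i
      rw [h, ← Matrix.mulVec_mulVec]
      exact SchmidtRankLE.tensorOp_mulVec _ (ih _)
  obtain ⟨n, M, e, -, h⟩ := hG r
  rw [h, ← Matrix.mulVec_mulVec]
  exact SchmidtRankLE.tensorOp_mulVec _ (key _ _)

theorem OpFamily.channel_pureState {V : Type} [Fintype V] [DecidableEq V] {X : V → Type}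
    [∀ v, Fintype (X v)] (F : OpFamily X) (φ : (∀ v, X v) → ℂ) :
    F.channel (pureState φ) = ∑ i, pureState (F.op i *ᵥ φ) := by
  refine Finset.sum_congr rfl fun i _ => ?_
  rw [pureState, Matrix.mul_vecMulVec, Matrix.vecMulVec_mul, pureState, Matrix.star_mulVec]

/-- The computational basis state in which the qubits `p, x, q, y` have the values `s`, and all
the others the value `0`. -/
def fourQubitIndex (p x q y : Fin 8) (s : (Fin 2 × Fin 2) × (Fin 2 × Fin 2)) : Fin 8 → Fin 2 :=
  fun v => if v = p then s.1.1 else if v = x then s.1.2 else if v = q then s.2.1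
    else if v = y then s.2.2 else 0

/-- The matrix of amplitudes of `η` at the indices `fourQubitIndex`. -/
def fourQubitSlice (p x q y : Fin 8) (η : (Fin 8 → Fin 2) → ℂ) :
    Matrix (Fin 2 × Fin 2) (Fin 2 × Fin 2) ℂ :=
  fun a b => η (fourQubitIndex p x q y (a, b))

/-- A witness, linear in the state, that is nonnegative on the states of Schmidt rank at most `3`
between the qubits `p, x` and the qubits `q, y`. -/
noncomputable def rankWitness (p x q y : Fin 8) (σ : Matrix (Fin 8 → Fin 2) (Fin 8 → Fin 2) ℂ) :
    ℝ :=
  (12 * (∑ s, σ (fourQubitIndex p x q y s) (fourQubitIndex p x q y s)) -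
    ∑ s, ∑ t, star (twoPairs s.1 s.2) *
      σ (fourQubitIndex p x q y s) (fourQubitIndex p x q y t) * twoPairs t.1 t.2).re

theorem rankWitness_add (p x q y : Fin 8) (σ τ : Matrix (Fin 8 → Fin 2) (Fin 8 → Fin 2) ℂ) :
    rankWitness p x q y (σ + τ) = rankWitness p x q y σ + rankWitness p x q y τ := by
  simp only [rankWitness, Matrix.add_apply, mul_add, add_mul, Finset.sum_add_distrib,
    Complex.sub_re, Complex.add_re]
  ring

theorem rankWitness_zero (p x q y : Fin 8) : rankWitness p x q y 0 = 0 := by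
  simp [rankWitness]

theorem rankWitness_sum_nonneg {ι : Type} (s : Finset ι) {p x q y : Fin 8}
    {σ : ι → Matrix (Fin 8 → Fin 2) (Fin 8 → Fin 2) ℂ}
    (h : ∀ i ∈ s, 0 ≤ rankWitness p x q y (σ i)) : 0 ≤ rankWitness p x q y (∑ i ∈ s, σ i) :=
  Finset.sum_induction σ (fun τ => 0 ≤ rankWitness p x q y τ)
    (fun a b ha hb => by rw [rankWitness_add]; exact add_nonneg ha hb)
    (rankWitness_zero p x q y).ge h

theorem continuous_rankWitness (p x q y : Fin 8) : Continuous (rankWitness p x q y) := by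
  unfold rankWitness
  fun_prop

theorem continuous_traceAux : Continuous traceAux := by
  unfold traceAux
  refine continuous_matrix fun s t => ?_
  fun_prop

theorem rankWitness_pureState (p x q y : Fin 8) (η : (Fin 8 → Fin 2) → ℂ) :
    rankWitness p x q y (pureState η) =
      12 * ∑ a, ∑ b, ‖fourQubitSlice p x q y η a b‖ ^ 2 -
        ‖(twoPairsᴴ * fourQubitSlice p x q y η).trace‖ ^ 2 := by
  have h : (twoPairsᴴ * fourQubitSlice p x q y η).trace =
      ∑ s : (Fin 2 × Fin 2) × (Fin 2 × Fin 2),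
        star (twoPairs s.1 s.2) * η (fourQubitIndex p x q y s) := by
    rw [Fintype.sum_prod_type]
    simp only [Matrix.trace, Matrix.diag, Matrix.mul_apply, Matrix.conjTranspose_apply]
    exact Finset.sum_comm
  apply Complex.ofReal_injective
  have h1 : ∑ s, pureState η (fourQubitIndex p x q y s) (fourQubitIndex p x q y s) =
      ((∑ a, ∑ b, ‖fourQubitSlice p x q y η a b‖ ^ 2 : ℝ) : ℂ) := by
    rw [Fintype.sum_prod_type]
    push_cast
    refine Finset.sum_congr rfl fun a _ => Finset.sum_congr rfl fun b _ => ?_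
    simp [pureState, Matrix.vecMulVec_apply, fourQubitSlice, Complex.mul_conj']
  have h2 : ∑ s, ∑ t, star (twoPairs s.1 s.2) * pureState η (fourQubitIndex p x q y s)
      (fourQubitIndex p x q y t) * twoPairs t.1 t.2 =
      ((‖(twoPairsᴴ * fourQubitSlice p x q y η).trace‖ ^ 2 : ℝ) : ℂ) := by
    push_cast
    rw [← Complex.mul_conj', h, map_sum, Finset.sum_mul_sum]
    refine Finset.sum_congr rfl fun s _ => Finset.sum_congr rfl fun t _ => ?_
    simp [pureState, Matrix.vecMulVec_apply]
    ring
  rw [rankWitness, h1, h2]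
  norm_cast

/-- The partial trace is a sum of pure states, one for each auxiliary basis index; fixing that index
and the remaining qubits preserves the rank bound. -/
theorem rankWitness_traceAux_nonneg {A : Set (Fin 8)} {p x q y : Fin 8} (hp : p ∈ A) (hx : x ∈ A)
    (hq : q ∉ A) (hy : y ∉ A) {φ : (∀ k, LocalBasis k) → ℂ} (h : SchmidtRankLE A 2 φ) :
    0 ≤ rankWitness p x q y (traceAux (pureState φ)) := by
  have htr : traceAux (pureState φ) =
      ∑ a : (∀ k, Fin (auxDim k)), pureState (fun s => φ (fun k => (s k, a k))) := by
    ext s t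
    simp [traceAux, Matrix.sum_apply, pureState, Matrix.vecMulVec_apply]
  rw [htr]
  refine rankWitness_sum_nonneg _ fun a _ => ?_
  rw [rankWitness_pureState, sub_nonneg]
  obtain ⟨f, g, h⟩ := h
  -- The zeros are dummies: `q`, `y` lie outside `A` and `p`, `x` inside, so neither factor sees the
  -- other pair's values.
  refine norm_trace_twoPairs_sq_le _
    (fun k i => f k fun v => (fourQubitIndex p x q y (i, 0) v, a v))
    (fun k j => g k fun v => (fourQubitIndex p x q y (0, j) v, a v)) fun i j => ?_
  rw [fourQubitSlice, h]
  refine Finset.sum_congr rfl fun k _ => ?_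
  congr 2
  · ext v : 1
    have h1 : (v : Fin 8) ≠ q := fun h => hq (h ▸ v.2)
    have h2 : (v : Fin 8) ≠ y := fun h => hy (h ▸ v.2)
    simp [fourQubitIndex, h1, h2]
  · ext v : 1
    have h1 : (v : Fin 8) ≠ p := fun h => v.2 (h ▸ hp)
    have h2 : (v : Fin 8) ≠ x := fun h => v.2 (h ▸ hx)
    simp [fourQubitIndex, h1, h2]

/-- An LOCC map does not transform a state of Schmidt rank at most `2` into a state containing two
entangled pairs shared across the bipartition. -/
theorem not_locc_to_twoPairs {A : Set (Fin 8)} {p x q y : Fin 8} (hp : p ∈ A) (hx : x ∈ A)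
    (hq : q ∉ A) (hy : y ∉ A) {φ : (∀ k, LocalBasis k) → ℂ} (h : SchmidtRankLE A 2 φ)
    {E : Matrix (∀ k, LocalBasis k) (∀ k, LocalBasis k) ℂ →ₗ[ℂ]
      Matrix (∀ k, LocalBasis k) (∀ k, LocalBasis k) ℂ} (hE : IsLOCCMap E)
    {ψ : (Fin 8 → Fin 2) → ℂ} (hψ : traceAux (E (pureState φ)) = pureState ψ)
    {c : ℂ} (hc : c ≠ 0) : fourQubitSlice p x q y ψ ≠ c • twoPairs := by
  intro hslice
  obtain ⟨F, G, h0, hF, hG, hlim⟩ := hE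
  have hcont := ((continuous_rankWitness p x q y).comp continuous_traceAux).tendsto
    (E (pureState φ))
  have hnonneg : 0 ≤ rankWitness p x q y (traceAux (E (pureState φ))) := by
    refine ge_of_tendsto' (hcont.comp (hlim (pureState φ))) fun r => ?_
    have htr : traceAux ((G r).channel (pureState φ)) =
        ∑ i, traceAux (pureState ((G r).op i *ᵥ φ)) := by
      rw [OpFamily.channel_pureState]
      ext s t
      simp only [traceAux, Matrix.sum_apply]
      exact Finset.sum_comm
    simp only [Function.comp_apply, htr]
    exact rankWitness_sum_nonneg _ fun i _ =>
      rankWitness_traceAux_nonneg hp hx hq hy (schmidtRankLE_of_locc h0 hF hG h r i)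
  -- The witness evaluates to (12 · 16 − 16²)‖c‖² = −64‖c‖², which is negative.
  rw [hψ, rankWitness_pureState, hslice, Matrix.mul_smul, twoPairs_conjTranspose_mul_self] at hnonneg
  have hn : ∀ a b, ‖twoPairs a b‖ = 1 := fun a b => by simp [twoPairs, norm_pairAmp]
  simp only [Matrix.smul_apply, norm_smul, hn, Matrix.trace_smul, Matrix.trace_one] at hnonneg
  have hcpos : 0 < ‖c‖ := norm_pos_iff.2 hc
  norm_num at hnonneg
  nlinarith [sq_nonneg ‖c‖, mul_pos hcpos hcpos]

/-! ### Circuit outputs: diagonal gates and the choice of angles -/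

theorem localOp_pauliZ (p : Fin 8) :
    localOp p pauliZ = Matrix.diagonal (fun z : Fin 8 → Fin 2 => pauliZ (z p) (z p)) := by
  ext a b
  rw [localOp, tensorOp]
  by_cases hab : a = b
  · subst hab
    rw [Matrix.diagonal_apply_eq, Fintype.prod_eq_single p]
    · simp
    · intro v hv
      simp [Function.update_of_ne hv]
  · rw [Matrix.diagonal_apply_ne _ hab]
    obtain ⟨v, hv⟩ := Function.ne_iff.1 hab
    refine Finset.prod_eq_zero (Finset.mem_univ v) ?_
    by_cases hvp : v = p
    · subst hvp
      rw [Function.update_self]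
      revert hv
      generalize a v = i
      generalize b v = j
      fin_cases i <;> fin_cases j <;> simp [pauliZ]
    · rw [Function.update_of_ne hvp, Matrix.one_apply_ne hv]

theorem zzGate_mulVec (α : ℝ) (p q : Fin 8) (ψ : (Fin 8 → Fin 2) → ℂ) (z : Fin 8 → Fin 2) :
    (zzGate α p q *ᵥ ψ) z =
      Complex.exp (Complex.I * α * (pauliZ (z p) (z p) * pauliZ (z q) (z q))) * ψ z := by
  rw [zzGate, zz, localOp_pauliZ, localOp_pauliZ, Matrix.diagonal_mul_diagonal,
    ← Matrix.diagonal_smul, Matrix.exp_diagonal, Matrix.mulVec_diagonal, Pi.coe_exp,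
    Complex.exp_eq_exp_ℂ]
  rfl

theorem circuitOutput_apply (w : Fin 7 → Fin 8 × Fin 8) (α : Fin 7 → ℝ) (z : Fin 8 → Fin 2) :
    circuitOutput w α z = (∏ j, Complex.exp (Complex.I * α j *
      (pauliZ (z (w j).1) (z (w j).1) * pauliZ (z (w j).2) (z (w j).2)))) * plusState z := by
  have key : ∀ (l : List (Fin 7)) (ψ : (Fin 8 → Fin 2) → ℂ),
      l.foldl (fun ψ j => zzGate (α j) (w j).1 (w j).2 *ᵥ ψ) ψ z =
        (l.map fun j => Complex.exp (Complex.I * α j *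
          (pauliZ (z (w j).1) (z (w j).1) * pauliZ (z (w j).2) (z (w j).2)))).prod * ψ z := by
    intro l
    induction l with
    | nil => simp
    | cons j l ih =>
      intro ψ
      rw [List.foldl_cons, ih, zzGate_mulVec, List.map_cons, List.prod_cons]
      ring
  rw [circuitOutput, key, Fin.prod_univ_def]

theorem exists_target_twoPairs (w : Fin 7 → Fin 8 × Fin 8) {p x q y : Fin 8}
    (hpq : (interactionGraph w).Adj p q) (hxy : (interactionGraph w).Adj x y)
    (hpx : p ≠ x) (hqy : q ≠ y) (hpy : p ≠ y) (hxq : x ≠ q) :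
    ∃ ψ ∈ targetSet w, ∃ c : ℂ, c ≠ 0 ∧ fourQubitSlice p x q y ψ = c • twoPairs := by
  have hsym : ∀ (u : Fin 8 × Fin 8) (a b : Fin 8), s(u.1, u.2) = s(a, b) → ∀ z : Fin 8 → Fin 2,
      Complex.exp (Complex.I * (Real.pi / 4 : ℝ) *
        (pauliZ (z u.1) (z u.1) * pauliZ (z u.2) (z u.2))) = pairAmp (z a) (z b) := by
    rintro ⟨u, v⟩ a b h z
    rcases Sym2.eq_iff.1 h with ⟨rfl, rfl⟩ | ⟨rfl, rfl⟩
    · rfl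
    · rw [pairAmp, mul_comm (pauliZ (z u) (z u))]
  obtain ⟨⟨i, hi⟩, hne⟩ := (SimpleGraph.fromEdgeSet_adj _).1 hpq
  obtain ⟨⟨j, hj⟩, hne'⟩ := (SimpleGraph.fromEdgeSet_adj _).1 hxy
  -- A single gate serving both edges would force `p = x` or `p = y`.
  have hij : i ≠ j := by
    rintro rfl
    rcases Sym2.eq_iff.1 (hi.symm.trans hj) with ⟨h, -⟩ | ⟨h, -⟩
    · exact hpx h
    · exact hpy h
  let α : Fin 7 → ℝ := fun k => if k = i ∨ k = j then Real.pi / 4 else 0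
  refine ⟨circuitOutput w α, ⟨α, fun k => ?_, rfl⟩, plusState 0, ?_, ?_⟩
  · have := Real.pi_pos
    simp only [α]
    split_ifs <;> constructor <;> linarith
  · simp [plusState]
  -- Gates at angle 0 contribute the factor 1, so only gates `i` and `j` remain, and `plusState` is
  -- constant.
  · ext a b
    rw [fourQubitSlice, circuitOutput_apply,
      Finset.prod_eq_mul i j hij (fun k _ hk => by simp [α, hk.1, hk.2]) (by simp) (by simp)]
    have h1 : α i = Real.pi / 4 := by simp [α]
    have h2 : α j = Real.pi / 4 := by simp [α]
    rw [h1, h2, hsym _ _ _ hi, hsym _ _ _ hj]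
    simp [fourQubitIndex, twoPairs, hpx.symm, hne.symm, hxq.symm, hpy.symm, hne'.symm, hqy.symm]
    rw [mul_comm]
    rfl

/-! ### Assembly -/

theorem mainTheorem9 (w : Fin 7 → Fin 8 × Fin 8)
    (hTree : (interactionGraph w).IsTree)
    (hPath : ¬ HasDominatingPathFrom (interactionGraph w) 7) :
    ¬ AchievableByBipartiteEntanglement (targetSet w) := by
  rintro ⟨φ, hφ, -, hent, hS⟩
  obtain ⟨m, hsymm, hdim, hprod, hcut⟩ := hφ.exists_bondRank
  -- The system sizes enter here: dimension at most 4 everywhere and 2 at `v₈`. A bipartition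
  -- without a heavy bond would make `φ` a product vector.
  obtain ⟨l, hnodup, hmem, hl⟩ := exists_linear_layout (7 : Fin 8) m hsymm
    (fun v s => (hdim v s).trans (by fin_cases v <;> simp))
    (fun s => (hdim 7 s).trans (by simp))
    (fun A hA hA' => by
      by_contra hcon
      push Not at hcon
      exact hent.not_schmidtRankLE_one hA hA' (hprod A hcon))
    (fun A => SchmidtRankLE A 2 φ)
    (fun A v hv w hw hm hm' huniq => (hcut A v hv w hw hm huniq).mono hm')
  obtain ⟨s, hs, hnil, hne, p, x, q, y, hp, hx, hq, hy, hpx, hqy, hpq, hxy⟩ :=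
    exists_suffix_crossed_by_disjoint_edges hTree.connected hPath hnodup hmem
      fun s hs hnil => (hl s hs hnil).1
  obtain ⟨ψ, hψ, c, hc, hslice⟩ := exists_target_twoPairs w hpq hxy hpx hqy
    (fun h => hy (h ▸ hp)) (fun h => hq (h ▸ hx))
  obtain ⟨E, hE, hEψ⟩ := hS ψ hψ
  exact not_locc_to_twoPairs hp hx hq hy ((hl s hs hnil).2 hne) hE hEψ hc hslice
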